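/- Let $X$ be a compact metric space, $T:X\to X$ a continuous map and $d\ge 1$. Let $\mathcal M(X,T)$ and $\mathcal M^e(X,T)$ denote the sets of $T$-invariant, respectively $T$-ergodic, Borel probability measures on $X$, with the topology of weak convergence. Let $C(X,GL_d(\mathbb R))$ be the space of continuous maps $A:X\to GL_d(\mathbb R)$ with the metric $\rho(A,B)=\max_{x\in X}\{\|A(x)-B(x)\|+\|A(x)^{-1}-B(x)^{-1}\|\}$, where $\|\cdot\|$ is the Euclidean operator norm. For $A\in C(X,GL_d(\mathbb R))$ and $n\ge 1$ put $A(n,x)=A(T^{n-1}x)\cdots A(Tx)A(x)$, and for $\Lambda\subseteq\mathcal M(X,T)$ let $$\beta^\Lambda(A)=\sup_{\mu\in\Lambda}\inf_{n\ge1}\frac1n\int\log\|A(n,x)\|\,d\mu(x),$$ $$\mathcal M^\Lambda_{\max}(A)=\Big\{\mu\in\Lambda : \inf_{n\ge1}\frac1n\int\log\|A(n,x)\|\,d\mu(x)=\beta^\Lambda(A)\Big\},$$ $$\mathcal U^\Lambda=\{A\in C(X,GL_d(\mathbb R)) : \mathcal M^\Lambda_{\max}(A)\text{ is a singleton}\},\qquad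 \mathcal U=\mathcal U^{\mathcal M(X,T)}.$$ A set is called residual if it has a dense $G_\delta$ subset. Let $\Lambda$ be a nonempty compact subset of $\mathcal M(X,T)$. Then: (1) $\mathcal U^\Lambda$ is residual in $C(X,GL_d(\mathbb R))$; in particular, $\mathcal U$ is residual in $C(X,GL_d(\mathbb R))$. (2) If $\Lambda$ is finite, then $C(X,GL_d(\mathbb R))\setminus\mathcal U^\Lambda$ is nowhere dense in $C(X,GL_d(\mathbb R))$. (3) If $\overline{\Lambda\cap\mathcal M^e(X,T)}=\Lambda$ and $\mathcal F$ is a dense subset of $C(X,GL_d(\mathbb R))$, then $\bigcup_{A\in\mathcal F}\mathcal M^\Lambda_{\max}(A)$ is dense in $\Lambda$. -/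

import Mathlib

open MeasureTheory Topology

noncomputable section

namespace LyapunovOptimisation

/-- The operator norm of a real square matrix with respect to the Euclidean norm on `ℝ^d`. -/
def opNorm {d : ℕ} (M : Matrix (Fin d) (Fin d) ℝ) : ℝ :=
  ‖Matrix.toEuclideanCLM (𝕜 := ℝ) M‖

/-- The metric `ρ(A,B) = max_x (‖A(x) - B(x)‖ + ‖A(x)⁻¹ - B(x)⁻¹‖)` on `C(X, GL_d(ℝ))`.
That it induces the topology which Mathlib puts on `C(X, GL_d(ℝ))` is `nhds_hasBasis_rho`. -/
def rho {X : Type*} [TopologicalSpace X] {d : ℕ} (A B : C(X, GL (Fin d) ℝ)) : ℝ :=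
  ⨆ x : X, (opNorm ((A x : Matrix (Fin d) (Fin d) ℝ) - (B x : Matrix (Fin d) (Fin d) ℝ)) +
    opNorm ((((A x)⁻¹ : GL (Fin d) ℝ) : Matrix (Fin d) (Fin d) ℝ) -
      (((B x)⁻¹ : GL (Fin d) ℝ) : Matrix (Fin d) (Fin d) ℝ)))

/-- The balls of `ρ` around `A` form a basis of neighbourhoods of `A` in `C(X, GL_d(ℝ))`. -/
theorem nhds_hasBasis_rho {X : Type*} [TopologicalSpace X] [CompactSpace X] {d : ℕ}
    (A : C(X, GL (Fin d) ℝ)) :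
    (𝓝 A).HasBasis (fun ε : ℝ => 0 < ε) (fun ε => {B | rho A B < ε}) := by
  open scoped Matrix.Norms.L2Operator in
  let e : C(GL (Fin d) ℝ, Matrix (Fin d) (Fin d) ℝ × (Matrix (Fin d) (Fin d) ℝ)ᵐᵒᵖ) :=
    ⟨Units.embedProduct _, Units.continuous_embedProduct⟩
  have he : IsInducing e := Units.isInducing_embedProduct
  have hi : IsInducing (fun B : C(X, GL (Fin d) ℝ) => e.comp B) := e.isInducing_postcomp he
  have hn : ∀ M : Matrix (Fin d) (Fin d) ℝ, opNorm M = ‖M‖ := fun M => rfl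
  have hd : ∀ (B : C(X, GL (Fin d) ℝ)) (x : X), dist (e.comp B x) (e.comp A x) =
      max (opNorm ((A x : Matrix (Fin d) (Fin d) ℝ) - (B x : Matrix (Fin d) (Fin d) ℝ)))
      (opNorm ((((A x)⁻¹ : GL (Fin d) ℝ) : Matrix (Fin d) (Fin d) ℝ) -
      (((B x)⁻¹ : GL (Fin d) ℝ) : Matrix (Fin d) (Fin d) ℝ))) := by
    intro B x
    rw [dist_comm, Prod.dist_eq, hn, hn, ← dist_eq_norm, ← dist_eq_norm]
    rfl
  have h0 : ∀ M : Matrix (Fin d) (Fin d) ℝ, 0 ≤ opNorm M := fun M => norm_nonneg _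
  rw [hi.nhds_eq_comap]
  refine (Metric.nhds_basis_ball.comap _).to_hasBasis ?_ ?_
  · intro ε hε
    refine ⟨ε, hε, fun B hB => ?_⟩
    rw [Set.mem_preimage, Metric.mem_ball]
    refine lt_of_le_of_lt ?_ (show rho A B < ε from hB)
    have hb : BddAbove (Set.range fun x : X =>
        (opNorm ((A x : Matrix (Fin d) (Fin d) ℝ) - (B x : Matrix (Fin d) (Fin d) ℝ)) +
        opNorm ((((A x)⁻¹ : GL (Fin d) ℝ) : Matrix (Fin d) (Fin d) ℝ) -
          (((B x)⁻¹ : GL (Fin d) ℝ) : Matrix (Fin d) (Fin d) ℝ)))) := by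
      refine ⟨2 * dist (e.comp B) (e.comp A), ?_⟩
      rintro _ ⟨x, rfl⟩
      have h1 := ContinuousMap.dist_apply_le_dist (f := e.comp B) (g := e.comp A) x
      rw [hd] at h1
      have h2 := (le_max_left _ _).trans h1
      have h3 := (le_max_right _ _).trans h1
      dsimp only
      linarith
    refine (ContinuousMap.dist_le (Real.iSup_nonneg fun x => add_nonneg (h0 _) (h0 _))).2 ?_
    intro x
    rw [hd]
    refine le_trans ?_ (le_ciSup hb x)
    exact max_le (le_add_of_nonneg_right (h0 _)) (le_add_of_nonneg_left (h0 _))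
  · intro ε hε
    refine ⟨ε / 3, by positivity, fun B hB => ?_⟩
    rw [Set.mem_preimage, Metric.mem_ball] at hB
    refine lt_of_le_of_lt (b := 2 * (ε / 3)) ?_ (by linarith)
    refine Real.iSup_le (fun x => ?_) (by positivity)
    have h1 := ContinuousMap.dist_apply_le_dist (f := e.comp B) (g := e.comp A) x
    rw [hd] at h1
    have h2 := (le_max_left _ _).trans h1
    have h3 := (le_max_right _ _).trans h1
    linarith

/-- The matrix product `A(n,x) = A(T^{n-1} x) ⋯ A(T x) A(x)`. -/
def cocycle {X : Type*} [TopologicalSpace X] {d : ℕ} (T : X → X) (A : C(X, GL (Fin d) ℝ)) :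
    ℕ → X → GL (Fin d) ℝ
  | 0, _ => 1
  | n + 1, x => A (T^[n] x) * cocycle T A n x

/-- The space `M(X,T)` of `T`-invariant Borel probability measures. It is a subset of
`ProbabilityMeasure X`, whose topology is that of weak convergence. -/
def invariantMeasures {X : Type*} [MeasurableSpace X] (T : X → X) :
    Set (ProbabilityMeasure X) :=
  {μ | MeasurePreserving T (μ : Measure X) (μ : Measure X)}

/-- The space `M^e(X,T)` of `T`-ergodic Borel probability measures. -/
def ergodicMeasures {X : Type*} [MeasurableSpace X] (T : X → X) :
    Set (ProbabilityMeasure X) :=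
  {μ | Ergodic T (μ : Measure X)}

/-- The top Lyapunov exponent `inf_{n ≥ 1} (1/n) ∫ log ‖A(n,x)‖ dμ` of `A` with respect to `μ`.
The integrands are continuous for `d ≥ 1`, and the terms are bounded below by
`-max_x log ‖A(x)⁻¹‖` for invariant `μ`. -/
def topExponent {X : Type*} [TopologicalSpace X] [MeasurableSpace X] {d : ℕ} (T : X → X)
    (A : C(X, GL (Fin d) ℝ)) (μ : ProbabilityMeasure X) : ℝ :=
  ⨅ n : ℕ+, (1 / ((n : ℕ) : ℝ)) *
    ∫ x, Real.log (opNorm (cocycle T A n x : Matrix (Fin d) (Fin d) ℝ)) ∂(μ : Measure X)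

/-- `β^Λ(A)`, the supremum over `μ ∈ Λ` of the top Lyapunov exponent. -/
def maxExponent {X : Type*} [TopologicalSpace X] [MeasurableSpace X] {d : ℕ} (T : X → X)
    (Λ : Set (ProbabilityMeasure X)) (A : C(X, GL (Fin d) ℝ)) : ℝ :=
  sSup (topExponent T A '' Λ)

/-- The set of `Λ`-maximising measures of `A`. -/
def maximisingMeasures {X : Type*} [TopologicalSpace X] [MeasurableSpace X] {d : ℕ} (T : X → X)
    (Λ : Set (ProbabilityMeasure X)) (A : C(X, GL (Fin d) ℝ)) : Set (ProbabilityMeasure X) :=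
  {μ | μ ∈ Λ ∧ topExponent T A μ = maxExponent T Λ A}

/-- `U^Λ`, the set of those `A` in `C(X, GL_d(ℝ))` that have exactly one `Λ`-maximising
measure. -/
def uniquelyMaximised {X : Type*} [TopologicalSpace X] [MeasurableSpace X] (d : ℕ) (T : X → X)
    (Λ : Set (ProbabilityMeasure X)) : Set C(X, GL (Fin d) ℝ) :=
  {A | ∃ μ, maximisingMeasures T Λ A = {μ}}

/-- A set is residual if it has a dense `Gδ` subset (the standard definition in Baire spaces). -/
def IsResidual {Y : Type*} [TopologicalSpace Y] (s : Set Y) : Prop :=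
  ∃ G : Set Y, G ⊆ s ∧ IsGδ G ∧ Dense G

end LyapunovOptimisation

end

noncomputable section

namespace LyapunovOptimisation

open Filter

set_option linter.unusedSectionVars false

/-! ### The Euclidean operator norm and scalar matrices -/

section OpNorm

variable {d : ℕ}

/-! Everything rests on scalar perturbations: for invariant `μ`, replacing `A` by `e^g A` adds
exactly `∫ g dμ` to the exponent (`topExponent_expMul`). The exponent is an infimum of jointly
continuous functions of `(A, μ)`, hence upper semicontinuous, and by compactness of `Λ` so is its
maximum `β`.

(1) If `μ` and `ν` both maximise `A`, then `β(e^{tg}A) ≥ β(A) + t∫ g dμ` and `β(e^{-tg}A) ≥ β(A) -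
t∫ g dν`, so the second difference of `β` in direction `g` bounds `t(∫ g dμ - ∫ g dν)`. Since `s ↦
β(e^{sg}A)` is Lipschitz, its second differences telescope, and one of many equally spaced ones is
small relative to the step. Smallness is an open condition near continuity points of `β`, and an
upper semicontinuous function is continuous at residually many points. Thus for each `g` and `ε` the
good set has dense interior (`dense_interior_smallSecondDifference`). Intersecting over a dense
sequence of `g` and `ε = 1/(n+1)` leaves only one maximiser.

(2) For finite `Λ`, residually many `A` have a unique maximiser and all finitely many exponents
continuous at `A`; the strict inequalities then persist nearby.

(3) For ergodic `μ₀` and a neighbourhood `W`, the mean ergodic theorem supplies a continuous `F`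
with `∫ F` near `0` at `μ₀` and at most `-1` on `Λ \ W` (`exists_continuousMap_separating`). Every
generator close to `e^F` times the identity then has its maximisers in `W`. -/

theorem continuous_opNorm : Continuous (opNorm (d := d)) := by
  open scoped Matrix.Norms.L2Operator in
  exact continuous_norm (E := Matrix (Fin d) (Fin d) ℝ)

theorem opNorm_mul_le (M N : Matrix (Fin d) (Fin d) ℝ) : opNorm (M * N) ≤ opNorm M * opNorm N := by
  rw [opNorm, map_mul]
  exact norm_mul_le _ _

theorem opNorm_smul (c : ℝ) (M : Matrix (Fin d) (Fin d) ℝ) : opNorm (c • M) = |c| * opNorm M := by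
  rw [opNorm, map_smul, norm_smul, Real.norm_eq_abs, opNorm]

theorem opNorm_one [NeZero d] : opNorm (1 : Matrix (Fin d) (Fin d) ℝ) = 1 := by
  rw [opNorm, map_one, norm_one]

theorem opNorm_pos [NeZero d] (M : GL (Fin d) ℝ) : 0 < opNorm (M : Matrix (Fin d) (Fin d) ℝ) := by
  refine norm_pos_iff.2 fun h => M.ne_zero ?_
  exact (map_eq_zero_iff _ (EquivLike.injective _)).1 h

/-- The logarithm of the Euclidean operator norm on `GL_d(ℝ)`. -/
def logOpNorm (d : ℕ) [NeZero d] : C(GL (Fin d) ℝ, ℝ) where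
  toFun M := Real.log (opNorm (M : Matrix (Fin d) (Fin d) ℝ))
  continuous_toFun :=
    (continuous_opNorm.comp Units.continuous_val).log fun M => (opNorm_pos M).ne'

theorem logOpNorm_apply [NeZero d] (M : GL (Fin d) ℝ) :
    logOpNorm d M = Real.log (opNorm (M : Matrix (Fin d) (Fin d) ℝ)) := rfl

theorem logOpNorm_one [NeZero d] : logOpNorm d 1 = 0 := by
  simp [logOpNorm_apply, opNorm_one]

theorem logOpNorm_mul_le [NeZero d] (M N : GL (Fin d) ℝ) :
    logOpNorm d (M * N) ≤ logOpNorm d M + logOpNorm d N := by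
  simp only [logOpNorm_apply]
  rw [← Real.log_mul (opNorm_pos M).ne' (opNorm_pos N).ne']
  exact Real.log_le_log (opNorm_pos _) (opNorm_mul_le _ _)

/-- The scalar matrix `e^t`. -/
def expScalar (d : ℕ) : C(ℝ, GL (Fin d) ℝ) where
  toFun t := Units.map (algebraMap ℝ (Matrix (Fin d) (Fin d) ℝ)).toMonoidHom
    (Units.mk0 (Real.exp t) (Real.exp_ne_zero t))
  continuous_toFun := by
    refine Units.continuous_iff.2 ⟨?_, ?_⟩
    · exact (continuous_algebraMap ℝ (Matrix (Fin d) (Fin d) ℝ)).comp Real.continuous_exp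
    · exact (continuous_algebraMap ℝ (Matrix (Fin d) (Fin d) ℝ)).comp
        (Real.continuous_exp.inv₀ Real.exp_ne_zero)

theorem coe_expScalar (t : ℝ) : (expScalar d t : Matrix (Fin d) (Fin d) ℝ) =
    algebraMap ℝ (Matrix (Fin d) (Fin d) ℝ) (Real.exp t) := rfl

theorem expScalar_add (s t : ℝ) : expScalar d (s + t) = expScalar d s * expScalar d t := by
  ext1
  rw [Units.val_mul, coe_expScalar, coe_expScalar, coe_expScalar, Real.exp_add, map_mul]

theorem expScalar_zero : expScalar d 0 = 1 := by
  ext1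
  rw [coe_expScalar, Real.exp_zero, map_one, Units.val_one]

theorem expScalar_mul_comm (t : ℝ) (M : GL (Fin d) ℝ) :
    expScalar d t * M = M * expScalar d t := by
  ext1
  rw [Units.val_mul, Units.val_mul, coe_expScalar, Algebra.commutes]

theorem logOpNorm_expScalar_mul [NeZero d] (t : ℝ) (M : GL (Fin d) ℝ) :
    logOpNorm d (expScalar d t * M) = t + logOpNorm d M := by
  simp only [logOpNorm_apply]
  rw [Units.val_mul, coe_expScalar, ← Algebra.smul_def, opNorm_smul, Real.abs_exp,
    Real.log_mul (Real.exp_ne_zero t) (opNorm_pos M).ne', Real.log_exp]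

end OpNorm

/-! ### Cocycles and their scalar perturbations -/

section Cocycle

variable {X : Type*} [TopologicalSpace X] [LocallyCompactSpace X] {d : ℕ} {T : X → X}

/-- The cocycle generator `e^g A`. -/
def expMul (g : C(X, ℝ)) (A : C(X, GL (Fin d) ℝ)) : C(X, GL (Fin d) ℝ) :=
  (expScalar d).comp g * A

theorem expMul_apply (g : C(X, ℝ)) (A : C(X, GL (Fin d) ℝ)) (x : X) :
    expMul g A x = expScalar d (g x) * A x := rfl

theorem expMul_add (f g : C(X, ℝ)) (A : C(X, GL (Fin d) ℝ)) :
    expMul (f + g) A = expMul f (expMul g A) := by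
  ext1 x
  simp only [expMul_apply, ContinuousMap.add_apply, expScalar_add, mul_assoc]

theorem expMul_zero (A : C(X, GL (Fin d) ℝ)) : expMul 0 A = A := by
  ext1 x
  simp only [expMul_apply, ContinuousMap.zero_apply, expScalar_zero, one_mul]

theorem continuous_expMul_right (g : C(X, ℝ)) :
    Continuous (expMul g : C(X, GL (Fin d) ℝ) → C(X, GL (Fin d) ℝ)) :=
  continuous_const.mul continuous_id

/-- Multiplication by `e^g` as a homeomorphism of `C(X, GL_d(ℝ))`. -/
def expMulHomeomorph (d : ℕ) (g : C(X, ℝ)) : C(X, GL (Fin d) ℝ) ≃ₜ C(X, GL (Fin d) ℝ) where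
  toFun := expMul g
  invFun := expMul (-g)
  left_inv A := by rw [← expMul_add, neg_add_cancel, expMul_zero]
  right_inv A := by rw [← expMul_add, add_neg_cancel, expMul_zero]
  continuous_toFun := continuous_expMul_right g
  continuous_invFun := continuous_expMul_right (-g)

theorem cocycle_expMul (g : C(X, ℝ)) (A : C(X, GL (Fin d) ℝ)) (n : ℕ) (x : X) :
    cocycle T (expMul g A) n x = expScalar d (birkhoffSum T g n x) * cocycle T A n x := by
  induction n with
  | zero => simp [cocycle, expScalar_zero]
  | succ n ih =>
    rw [cocycle, cocycle, ih, expMul_apply, birkhoffSum_succ, add_comm, expScalar_add, mul_assoc,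
      mul_assoc, ← mul_assoc (A _), ← expScalar_mul_comm _ (A _), mul_assoc]

theorem exists_continuous_cocycle (hT : Continuous T) (n : ℕ) :
    ∃ Φ : C(X, GL (Fin d) ℝ) → C(X, GL (Fin d) ℝ),
      Continuous Φ ∧ ∀ A x, Φ A x = cocycle T A n x := by
  induction n with
  | zero => exact ⟨fun _ => 1, continuous_const, fun _ _ => rfl⟩
  | succ n ih =>
    obtain ⟨Φ, hΦ, h⟩ := ih
    refine ⟨fun A => A.comp ⟨T^[n], hT.iterate n⟩ * Φ A,
      (ContinuousMap.continuous_precomp _).mul hΦ, fun A x => ?_⟩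
    rw [cocycle, ← h]
    rfl

theorem logOpNorm_cocycle_le [NeZero d] {A : C(X, GL (Fin d) ℝ)} {c : ℝ}
    (hA : ∀ x, logOpNorm d (A x) ≤ c) (n : ℕ) (x : X) :
    logOpNorm d (cocycle T A n x) ≤ n * c := by
  induction n with
  | zero => simp [cocycle, logOpNorm_one]
  | succ n ih =>
    rw [cocycle]
    have h1 := logOpNorm_mul_le (A (T^[n] x)) (cocycle T A n x)
    have h2 := hA (T^[n] x)
    push_cast
    linarith

/-- Submultiplicativity applied to `A(n,x) = A(T^n x)⁻¹ A(n+1,x)`. -/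
theorem le_logOpNorm_cocycle [NeZero d] {A : C(X, GL (Fin d) ℝ)} {c : ℝ}
    (hA : ∀ x, logOpNorm d (A x)⁻¹ ≤ c) (n : ℕ) (x : X) :
    n * (-c) ≤ logOpNorm d (cocycle T A n x) := by
  induction n with
  | zero => simp [cocycle, logOpNorm_one]
  | succ n ih =>
    have h1 := logOpNorm_mul_le (A (T^[n] x))⁻¹ (cocycle T A (n + 1) x)
    rw [cocycle, inv_mul_cancel_left, ← cocycle] at h1
    have h2 := hA (T^[n] x)
    push_cast
    linarith

end Cocycle

/-! ### The top exponent: bounds, semicontinuity, scalar shifts -/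

section Exponent

variable {X : Type*} [TopologicalSpace X] [CompactSpace X] [T2Space X] [MeasurableSpace X]
  [OpensMeasurableSpace X] {d : ℕ} {T : X → X}

theorem integrable_continuousMap (φ : C(X, ℝ)) (μ : ProbabilityMeasure X) :
    Integrable φ (μ : Measure X) :=
  (BoundedContinuousFunction.mkOfCompact φ).integrable _

theorem abs_integral_sub_integral_le (φ ψ : C(X, ℝ)) (μ : ProbabilityMeasure X) :
    |∫ x, φ x ∂(μ : Measure X) - ∫ x, ψ x ∂(μ : Measure X)| ≤ ‖φ - ψ‖ := by
  rw [← integral_sub (integrable_continuousMap φ μ) (integrable_continuousMap ψ μ),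
    ← Real.norm_eq_abs]
  refine (norm_integral_le_of_norm_le_const (C := ‖φ - ψ‖)
    (Eventually.of_forall fun x => (φ - ψ).norm_coe_le_norm x)).trans ?_
  simp

theorem continuous_integral_pairing :
    Continuous fun p : C(X, ℝ) × ProbabilityMeasure X => ∫ x, p.1 x ∂(p.2 : Measure X) := by
  refine continuous_iff_continuousAt.2 fun ⟨φ, μ⟩ => ?_
  have h1 : Tendsto (fun p : C(X, ℝ) × ProbabilityMeasure X => ∫ x, φ x ∂(p.2 : Measure X))
      (𝓝 (φ, μ)) (𝓝 (∫ x, φ x ∂(μ : Measure X))) :=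
    ((ProbabilityMeasure.continuous_integral_continuousMap φ).comp continuous_snd).tendsto (φ, μ)
  have h2 : Tendsto (fun p : C(X, ℝ) × ProbabilityMeasure X =>
      ∫ x, p.1 x ∂(p.2 : Measure X) - ∫ x, φ x ∂(p.2 : Measure X)) (𝓝 (φ, μ)) (𝓝 0) := by
    refine squeeze_zero_norm (fun p => abs_integral_sub_integral_le p.1 φ p.2) ?_
    have : Continuous fun p : C(X, ℝ) × ProbabilityMeasure X => ‖p.1 - φ‖ := by fun_prop
    simpa using this.tendsto (φ, μ)
  simpa [ContinuousAt] using h2.add h1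

/-- The finite-time exponent `(1/n) ∫ log ‖A(n,x)‖ dμ`. -/
def finiteExponent (T : X → X) (n : ℕ+) (A : C(X, GL (Fin d) ℝ)) (μ : ProbabilityMeasure X) : ℝ :=
  (1 / ((n : ℕ) : ℝ)) *
    ∫ x, Real.log (opNorm (cocycle T A n x : Matrix (Fin d) (Fin d) ℝ)) ∂(μ : Measure X)

theorem topExponent_eq_iInf (A : C(X, GL (Fin d) ℝ)) (μ : ProbabilityMeasure X) :
    topExponent T A μ = ⨅ n, finiteExponent T n A μ := rfl

variable [NeZero d]

theorem finiteExponent_eq {n : ℕ+} {A : C(X, GL (Fin d) ℝ)} {μ : ProbabilityMeasure X} :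
    finiteExponent T n A μ = (1 / ((n : ℕ) : ℝ)) *
      ∫ x, logOpNorm d (cocycle T A n x) ∂(μ : Measure X) := rfl

theorem continuous_finiteExponent (hT : Continuous T) (n : ℕ+) :
    Continuous fun p : C(X, GL (Fin d) ℝ) × ProbabilityMeasure X =>
      finiteExponent T n p.1 p.2 := by
  obtain ⟨Φ, hΦ, h⟩ := exists_continuous_cocycle (d := d) hT n
  simp_rw [finiteExponent_eq, ← h]
  refine continuous_const.mul (continuous_integral_pairing.comp
    (f := fun p : C(X, GL (Fin d) ℝ) × ProbabilityMeasure X => ((logOpNorm d).comp (Φ p.1), p.2))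
    ?_)
  exact (((logOpNorm d).continuous_postcomp).comp (hΦ.comp continuous_fst)).prodMk continuous_snd

theorem integrable_logOpNorm_cocycle (hT : Continuous T) (A : C(X, GL (Fin d) ℝ)) (n : ℕ)
    (μ : ProbabilityMeasure X) :
    Integrable (fun x => logOpNorm d (cocycle T A n x)) (μ : Measure X) := by
  obtain ⟨Φ, -, h⟩ := exists_continuous_cocycle (d := d) hT n
  simp_rw [← h]
  exact integrable_continuousMap ((logOpNorm d).comp (Φ A)) μ

theorem finiteExponent_le (hT : Continuous T) {A : C(X, GL (Fin d) ℝ)} {c : ℝ}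
    (hA : ∀ x, logOpNorm d (A x) ≤ c) (n : ℕ+) (μ : ProbabilityMeasure X) :
    finiteExponent T n A μ ≤ c := by
  have hn : (0 : ℝ) < (n : ℕ) := by exact_mod_cast n.pos
  rw [finiteExponent_eq, one_div, inv_mul_le_iff₀ hn]
  refine (integral_mono (integrable_logOpNorm_cocycle hT A n μ) (integrable_const (n * c))
    (logOpNorm_cocycle_le hA n)).trans ?_
  simp

theorem le_finiteExponent (hT : Continuous T) {A : C(X, GL (Fin d) ℝ)} {c : ℝ}
    (hA : ∀ x, logOpNorm d (A x)⁻¹ ≤ c) (n : ℕ+) (μ : ProbabilityMeasure X) :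
    -c ≤ finiteExponent T n A μ := by
  have hn : (0 : ℝ) < (n : ℕ) := by exact_mod_cast n.pos
  rw [finiteExponent_eq, one_div, le_inv_mul_iff₀ hn]
  refine le_trans (le_of_eq ?_) (integral_mono (integrable_const (n * -c))
    (integrable_logOpNorm_cocycle hT A n μ) (le_logOpNorm_cocycle hA n))
  simp

/-- Makes the real infimum genuine; an unbounded one would default to `0`. -/
theorem bddBelow_finiteExponent (hT : Continuous T) (A : C(X, GL (Fin d) ℝ))
    (μ : ProbabilityMeasure X) : BddBelow (Set.range fun n => finiteExponent T n A μ) := by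
  refine ⟨-‖(logOpNorm d).comp A⁻¹‖, ?_⟩
  rintro _ ⟨n, rfl⟩
  exact le_finiteExponent hT
    (fun x => (le_abs_self _).trans (((logOpNorm d).comp A⁻¹).norm_coe_le_norm x)) n μ

theorem topExponent_le (hT : Continuous T) {A : C(X, GL (Fin d) ℝ)} {c : ℝ}
    (hA : ∀ x, logOpNorm d (A x) ≤ c) (μ : ProbabilityMeasure X) : topExponent T A μ ≤ c :=
  (ciInf_le (bddBelow_finiteExponent hT A μ) 1).trans (finiteExponent_le hT hA 1 μ)

theorem le_topExponent (hT : Continuous T) {A : C(X, GL (Fin d) ℝ)} {c : ℝ}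
    (hA : ∀ x, logOpNorm d (A x)⁻¹ ≤ c) (μ : ProbabilityMeasure X) : -c ≤ topExponent T A μ :=
  le_ciInf fun n => le_finiteExponent hT hA n μ

theorem upperSemicontinuous_topExponent (hT : Continuous T) :
    UpperSemicontinuous fun p : C(X, GL (Fin d) ℝ) × ProbabilityMeasure X =>
      topExponent T p.1 p.2 := by
  intro p c hc
  obtain ⟨n, hn⟩ := exists_lt_of_ciInf_lt hc
  filter_upwards [(continuous_finiteExponent hT n).continuousAt.eventually_lt_const hn] with q hq
  exact (ciInf_le (bddBelow_finiteExponent hT q.1 q.2) n).trans_lt hq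

theorem integral_birkhoffSum (hT : Continuous T) {μ : ProbabilityMeasure X}
    (hμ : MeasurePreserving T (μ : Measure X) (μ : Measure X)) (g : C(X, ℝ)) (n : ℕ) :
    ∫ x, birkhoffSum T g n x ∂(μ : Measure X) = n * ∫ x, g x ∂(μ : Measure X) := by
  have hi : ∀ k, Integrable (fun x => g (T^[k] x)) (μ : Measure X) := fun k =>
    integrable_continuousMap (g.comp ⟨T^[k], hT.iterate k⟩) μ
  have hk : ∀ k, ∫ x, g (T^[k] x) ∂(μ : Measure X) = ∫ x, g x ∂(μ : Measure X) := by
    intro k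
    have h := hμ.iterate k
    rw [← integral_map h.measurable.aemeasurable
      (by rw [h.map_eq]; exact (integrable_continuousMap g μ).aestronglyMeasurable), h.map_eq]
  simp only [birkhoffSum]
  rw [integral_finsetSum _ fun k _ => hi k]
  simp [hk]

theorem finiteExponent_expMul (hT : Continuous T) {μ : ProbabilityMeasure X}
    (hμ : μ ∈ invariantMeasures T) (g : C(X, ℝ)) (A : C(X, GL (Fin d) ℝ)) (n : ℕ+) :
    finiteExponent T n (expMul g A) μ = ∫ x, g x ∂(μ : Measure X) + finiteExponent T n A μ := by
  have hn : ((n : ℕ) : ℝ) ≠ 0 := by exact_mod_cast n.ne_zero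
  have hb : Integrable (fun x => birkhoffSum T g n x) (μ : Measure X) := by
    refine integrable_continuousMap ⟨fun x => birkhoffSum T g n x, ?_⟩ μ
    simp only [birkhoffSum]
    exact continuous_finsetSum _ fun k _ => g.continuous.comp (hT.iterate k)
  simp_rw [finiteExponent_eq, cocycle_expMul, logOpNorm_expScalar_mul]
  rw [integral_add hb (integrable_logOpNorm_cocycle hT A n μ),
    integral_birkhoffSum hT (show MeasurePreserving T _ _ from hμ)]
  field_simp

/-- The scalar factors commute out of the product as the exponential of a Birkhoff sum, whose
integral is `n ∫ g dμ` by invariance; every finite-time exponent thus shifts by the same constant.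
-/
theorem topExponent_expMul (hT : Continuous T) {μ : ProbabilityMeasure X}
    (hμ : μ ∈ invariantMeasures T) (g : C(X, ℝ)) (A : C(X, GL (Fin d) ℝ)) :
    topExponent T (expMul g A) μ = ∫ x, g x ∂(μ : Measure X) + topExponent T A μ := by
  simp_rw [topExponent_eq_iInf, finiteExponent_expMul hT hμ]
  exact (add_ciInf (bddBelow_finiteExponent hT A μ) _).symm

end Exponent

/-! ### Continuity points of semicontinuous functions; Baire property -/

section Baire

theorem upperSemicontinuous_comp_continuous {Y Z : Type*} [TopologicalSpace Y]
    [TopologicalSpace Z] {f : Y → ℝ} (hf : UpperSemicontinuous f) {k : Z → Y}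
    (hk : Continuous k) : UpperSemicontinuous fun z => f (k z) :=
  fun z c h => (hk.tendsto z).eventually (hf (k z) c h)

/-- The superlevel sets at rational heights are closed, so their frontiers are nowhere dense. Off
these countably many frontiers `f` is also lower semicontinuous. -/
theorem eventually_residual_continuousAt {Y : Type*} [TopologicalSpace Y] {f : Y → ℝ}
    (hf : UpperSemicontinuous f) : ∀ᶠ y in residual Y, ContinuousAt f y := by
  have hc : ∀ q : ℚ, IsClosed {y | (q : ℝ) ≤ f y} := fun q => by
    refine ⟨?_⟩
    have h := upperSemicontinuous_iff_isOpen_preimage.1 hf q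
    convert h using 1
    ext y
    simp
  have h : ∀ᶠ y in residual Y, ∀ q : ℚ, y ∉ frontier {y | (q : ℝ) ≤ f y} := by
    refine eventually_countable_forall.2 fun q => ?_
    refine residual_of_dense_open isClosed_frontier.isOpen_compl ?_
    exact interior_eq_empty_iff_dense_compl.1 (interior_frontier (hc q))
  filter_upwards [h] with y hy
  refine tendsto_order.2 ⟨fun a ha => ?_, fun a ha => hf y a ha⟩
  obtain ⟨q, haq, hqy⟩ := exists_rat_btwn ha
  have hi : y ∈ interior {y | (q : ℝ) ≤ f y} := by
    by_contra hn
    exact hy q ⟨subset_closure hqy.le, hn⟩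
  filter_upwards [mem_interior_iff_mem_nhds.1 hi] with z hz
  exact haq.trans_le hz

/-- The map `A ↦ (A, A⁻¹)` is a closed embedding into continuous maps to a complete space: its range
is cut out by the pointwise closed condition of lying in the image of `GL`. -/
instance {X : Type*} [TopologicalSpace X] [CompactSpace X] {d : ℕ} :
    BaireSpace C(X, GL (Fin d) ℝ) := by
  open scoped Matrix.Norms.L2Operator in
  let e : C(GL (Fin d) ℝ, Matrix (Fin d) (Fin d) ℝ × (Matrix (Fin d) (Fin d) ℝ)ᵐᵒᵖ) :=
    ⟨Units.embedProduct _, Units.continuous_embedProduct⟩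
  have he : IsClosedEmbedding e := Units.isClosedEmbedding_embedProduct
  have h : IsClosedEmbedding (fun B : C(X, GL (Fin d) ℝ) => e.comp B) := by
    refine ⟨e.isEmbedding_postcomp he.isEmbedding, ?_⟩
    have : Set.range (fun B : C(X, GL (Fin d) ℝ) => e.comp B) =
        ⋂ x : X, (fun F : C(X, _) => F x) ⁻¹' Set.range e := by
      ext F
      simp only [Set.mem_range, Set.mem_iInter, Set.mem_preimage]
      constructor
      · rintro ⟨B, rfl⟩ x
        exact ⟨B x, rfl⟩
      · intro hF
        choose B hB using hF
        refine ⟨⟨B, he.isInducing.continuous_iff.2 ?_⟩, ?_⟩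
        · convert F.continuous using 1
          exact funext hB
        · ext1 x
          exact hB x
    rw [this]
    exact isClosed_iInter fun x => he.isClosed_range.preimage (continuous_eval_const x)
  have := h.IsCompletelyMetrizableSpace
  infer_instance

end Baire

/-! ### The maximal exponent and its second differences -/

section MaxExponent

variable {X : Type*} [TopologicalSpace X] [CompactSpace X] [T2Space X] [MeasurableSpace X]
  [OpensMeasurableSpace X] {d : ℕ} [NeZero d] {T : X → X} {Λ : Set (ProbabilityMeasure X)}

theorem exists_isGreatest_topExponent (hT : Continuous T) (hne : Λ.Nonempty) (hc : IsCompact Λ)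
    (A : C(X, GL (Fin d) ℝ)) : ∃ μ ∈ Λ, ∀ ν ∈ Λ, topExponent T A ν ≤ topExponent T A μ :=
  UpperSemicontinuousOn.exists_isMaxOn (f := topExponent T A) hne hc
    ((upperSemicontinuous_comp_continuous (upperSemicontinuous_topExponent hT)
      (Continuous.prodMk_right A)).upperSemicontinuousOn Λ)

theorem topExponent_le_maxExponent (hT : Continuous T) (A : C(X, GL (Fin d) ℝ))
    {μ : ProbabilityMeasure X} (hμ : μ ∈ Λ) : topExponent T A μ ≤ maxExponent T Λ A := by
  refine le_csSup ⟨‖(logOpNorm d).comp A‖, ?_⟩ ⟨μ, hμ, rfl⟩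
  rintro _ ⟨ν, -, rfl⟩
  exact topExponent_le hT
    (fun x => (le_abs_self _).trans (((logOpNorm d).comp A).norm_coe_le_norm x)) ν

theorem maximisingMeasures_nonempty (hT : Continuous T) (hne : Λ.Nonempty) (hc : IsCompact Λ)
    (A : C(X, GL (Fin d) ℝ)) : (maximisingMeasures T Λ A).Nonempty := by
  obtain ⟨μ, hμ, h⟩ := exists_isGreatest_topExponent hT hne hc A
  refine ⟨μ, hμ, (topExponent_le_maxExponent hT A hμ).antisymm (csSup_le (hne.image _) ?_)⟩
  rintro _ ⟨ν, hν, rfl⟩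
  exact h ν hν

theorem upperSemicontinuous_maxExponent (hT : Continuous T) (hne : Λ.Nonempty)
    (hc : IsCompact Λ) :
    UpperSemicontinuous (maxExponent T Λ : C(X, GL (Fin d) ℝ) → ℝ) := by
  intro A c hA
  have h : ∀ᶠ B in 𝓝 A, ∀ μ ∈ Λ, topExponent T B μ < c := by
    refine hc.eventually_forall_of_forall_eventually fun μ hμ => ?_
    exact upperSemicontinuous_topExponent hT (A, μ) c
      ((topExponent_le_maxExponent hT A hμ).trans_lt hA)
  filter_upwards [h] with B hB
  obtain ⟨μ, hμ, hm⟩ := maximisingMeasures_nonempty hT hne hc B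
  exact hm ▸ hB μ hμ

theorem maxExponent_expMul_le (hT : Continuous T) (hinv : Λ ⊆ invariantMeasures T)
    (hne : Λ.Nonempty) (g : C(X, ℝ)) (A : C(X, GL (Fin d) ℝ)) :
    maxExponent T Λ (expMul g A) ≤ ‖g‖ + maxExponent T Λ A := by
  refine csSup_le (hne.image _) ?_
  rintro _ ⟨μ, hμ, rfl⟩
  rw [topExponent_expMul hT (hinv hμ)]
  refine add_le_add ?_ (topExponent_le_maxExponent hT A hμ)
  simpa using (le_abs_self _).trans (abs_integral_sub_integral_le g 0 μ)

/-- The cocycle generators at which some second difference quotient of the maximal exponent in the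
scalar direction `g` is smaller than `ε`. -/
def smallSecondDifference (T : X → X) (Λ : Set (ProbabilityMeasure X)) (g : C(X, ℝ)) (ε : ℝ) :
    Set C(X, GL (Fin d) ℝ) :=
  {A | ∃ t : ℝ, 0 < t ∧ maxExponent T Λ (expMul (t • g) A) +
    maxExponent T Λ (expMul (-(t • g)) A) - 2 * maxExponent T Λ A < ε * t}

/-- Test `β(e^{tg}A)` with `μ` and `β(e^{-tg}A)` with `ν`, then add. -/
theorem integral_sub_integral_lt (hT : Continuous T) (hinv : Λ ⊆ invariantMeasures T)
    {g : C(X, ℝ)} {ε : ℝ} {A : C(X, GL (Fin d) ℝ)} (hA : A ∈ smallSecondDifference T Λ g ε)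
    {μ ν : ProbabilityMeasure X} (hμ : μ ∈ maximisingMeasures T Λ A)
    (hν : ν ∈ maximisingMeasures T Λ A) :
    ∫ x, g x ∂(μ : Measure X) - ∫ x, g x ∂(ν : Measure X) < ε := by
  obtain ⟨t, ht, h⟩ := hA
  have h1 := topExponent_le_maxExponent hT (expMul (t • g) A) hμ.1
  have h2 := topExponent_le_maxExponent hT (expMul (-(t • g)) A) hν.1
  rw [topExponent_expMul hT (hinv hμ.1), hμ.2] at h1
  rw [topExponent_expMul hT (hinv hν.1), hν.2] at h2
  simp only [ContinuousMap.neg_apply, ContinuousMap.smul_apply, smul_eq_mul, integral_neg,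
    integral_const_mul] at h1 h2
  refine lt_of_mul_lt_mul_right ?_ ht.le
  linarith

/-- The two shifted terms need only upper bounds, given by semicontinuity; continuity at `A` is
needed for the subtracted term. -/
theorem mem_interior_smallSecondDifference (hT : Continuous T) (hne : Λ.Nonempty)
    (hc : IsCompact Λ) {g : C(X, ℝ)} {ε t : ℝ} {A : C(X, GL (Fin d) ℝ)} (ht : 0 < t)
    (h : maxExponent T Λ (expMul (t • g) A) + maxExponent T Λ (expMul (-(t • g)) A) -
      2 * maxExponent T Λ A < ε * t)
    (hA : ContinuousAt (maxExponent T Λ : C(X, GL (Fin d) ℝ) → ℝ) A) :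
    A ∈ interior (smallSecondDifference T Λ g ε) := by
  rw [mem_interior_iff_mem_nhds]
  have hu := upperSemicontinuous_maxExponent (d := d) hT hne hc
  have h1 := (upperSemicontinuous_comp_continuous hu (continuous_expMul_right (t • g))) A
  have h2 := (upperSemicontinuous_comp_continuous hu (continuous_expMul_right (-(t • g)))) A
  -- The total error is `η + η + 2η`, so a fifth of the gap suffices.
  obtain ⟨η, hη, h⟩ : ∃ η > 0, maxExponent T Λ (expMul (t • g) A) +
      maxExponent T Λ (expMul (-(t • g)) A) - 2 * maxExponent T Λ A + 4 * η < ε * t :=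
    ⟨(ε * t - (maxExponent T Λ (expMul (t • g) A) +
      maxExponent T Λ (expMul (-(t • g)) A) - 2 * maxExponent T Λ A)) / 5, by linarith,
      by linarith⟩
  filter_upwards [h1 _ (lt_add_of_pos_right _ hη), h2 _ (lt_add_of_pos_right _ hη),
    hA.eventually_const_lt (sub_lt_self _ hη)] with B hB1 hB2 hB3
  exact ⟨t, ht, by linarith⟩

theorem exists_second_difference_le (b : ℕ → ℝ) (c : ℝ) (hb : ∀ j, |b (j + 1) - b j| ≤ c) {N : ℕ}
    (hN : 0 < N) : ∃ j < N, N * (b (j + 2) + b j - 2 * b (j + 1)) ≤ 2 * c := by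
  have hs : ∑ j ∈ Finset.range N, (b (j + 2) + b j - 2 * b (j + 1)) ≤ 2 * c := by
    have h : ∑ j ∈ Finset.range N, (b (j + 2) + b j - 2 * b (j + 1)) =
        (b (N + 1) - b N) - (b 1 - b 0) := by
      rw [← Finset.sum_range_sub (fun j => b (j + 1) - b j)]
      exact Finset.sum_congr rfl fun j _ => by ring
    rw [h]
    have h1 := abs_le.1 (hb N)
    have h2 := abs_le.1 (hb 0)
    linarith
  obtain ⟨j, hj, h⟩ := Finset.exists_le_of_sum_le
    (f := fun j => b (j + 2) + b j - 2 * b (j + 1)) (g := fun _ => 2 * c / N)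
    (Finset.nonempty_range_iff.2 hN.ne') (hs.trans (by simp; field_simp; rfl))
  have hN' : (0 : ℝ) < N := by exact_mod_cast hN
  exact ⟨j, Finset.mem_range.1 hj, by rw [mul_comm]; exact (le_div_iff₀ hN').1 h⟩

theorem dense_interior_smallSecondDifference (hT : Continuous T)
    (hinv : Λ ⊆ invariantMeasures T) (hne : Λ.Nonempty) (hc : IsCompact Λ) (g : C(X, ℝ)) {ε : ℝ}
    (hε : 0 < ε) :
    Dense (interior (smallSecondDifference T Λ g ε : Set C(X, GL (Fin d) ℝ))) := by
  -- The point of the line `s ↦ e^{sg}A` to be used is not yet known, so continuity is secured at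
  -- all rational parameters at once.
  have hres : Dense {A : C(X, GL (Fin d) ℝ) |
      ∀ q : ℚ, ContinuousAt (maxExponent T Λ : C(X, GL (Fin d) ℝ) → ℝ)
        (expMul ((q : ℝ) • g) A)} := by
    refine dense_of_mem_residual (eventually_countable_forall.2 fun q => ?_)
    have hu : UpperSemicontinuous fun A : C(X, GL (Fin d) ℝ) =>
        maxExponent T Λ (expMul ((q : ℝ) • g) A) :=
      upperSemicontinuous_comp_continuous (upperSemicontinuous_maxExponent hT hne hc)
        (continuous_expMul_right _)
    filter_upwards [eventually_residual_continuousAt hu] with A hA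
    -- Continuity of `β(e^{qg} ·)` at `A` is continuity of `β` at `e^{qg}A`.
    exact (expMulHomeomorph d ((q : ℝ) • g)).comp_continuousAt_iff' _ _ |>.1 hA
  rw [dense_iff_inter_open]
  intro V hV hVne
  obtain ⟨A, hAV, hA⟩ := hres.inter_open_nonempty V hV hVne
  -- With Lipschitz step `t‖g‖`, some second difference is at most `2t‖g‖/N < εt`.
  obtain ⟨N, hN⟩ := exists_nat_gt (2 * ‖g‖ / ε)
  have hN0 : (0 : ℝ) < N := lt_of_le_of_lt (by positivity) hN
  have hev : ∀ᶠ s in 𝓝 (0 : ℝ), expMul (s • g) A ∈ V := by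
    have hcont : Continuous fun s : ℝ => expMul (s • g) A :=
      (((expScalar d).continuous_postcomp).comp (continuous_id.smul continuous_const)).mul
        continuous_const
    refine hcont.continuousAt.eventually_mem (hV.mem_nhds ?_)
    rwa [zero_smul, expMul_zero]
  obtain ⟨δ, hδ, hball⟩ := Metric.eventually_nhds_iff.1 hev
  -- All multiples `(j+1)t` with `j < N` stay below `δ`, and `t` rational keeps them among the
  -- continuity parameters.
  obtain ⟨t, ht0, htδ⟩ := exists_rat_btwn (show (0 : ℝ) < δ / (N + 1) by positivity)
  have hshift : ∀ s r : ℝ, expMul (s • g) (expMul (r • g) A) = expMul ((s + r) • g) A := by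
    intro s r
    rw [add_smul, expMul_add]
  obtain ⟨j, hj, h⟩ := exists_second_difference_le
    (fun j => maxExponent T Λ (expMul ((j * (t : ℝ)) • g) A)) (t * ‖g‖) (fun j => by
      have h1 := maxExponent_expMul_le hT hinv hne ((t : ℝ) • g) (expMul ((j * (t : ℝ)) • g) A)
      have h2 := maxExponent_expMul_le hT hinv hne ((-t : ℝ) • g)
        (expMul (((j + 1 : ℕ) * (t : ℝ)) • g) A)
      rw [hshift, norm_smul, Real.norm_eq_abs] at h1 h2
      rw [abs_neg, abs_of_pos ht0] at h2
      rw [abs_of_pos ht0] at h1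
      have e1 : (t : ℝ) + j * t = (j + 1 : ℕ) * t := by push_cast; ring
      have e2 : -(t : ℝ) + (j + 1 : ℕ) * t = j * t := by push_cast; ring
      rw [e1] at h1
      rw [e2] at h2
      exact abs_le.2 ⟨by linarith, by linarith⟩) (by exact_mod_cast hN0)
  have hq : ((((j + 1 : ℕ) : ℚ) * t : ℚ) : ℝ) = (j + 1 : ℕ) * t := by push_cast; ring
  refine ⟨expMul (((j + 1 : ℕ) * (t : ℝ)) • g) A, hball ?_,
    mem_interior_smallSecondDifference hT hne hc ht0 ?_ (hq ▸ hA (((j + 1 : ℕ) : ℚ) * t))⟩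
  · rw [dist_zero_right, Real.norm_of_nonneg (by positivity)]
    rw [lt_div_iff₀ (by positivity)] at htδ
    have hj' : ((j + 1 : ℕ) : ℝ) ≤ N + 1 := by exact_mod_cast (Nat.succ_lt_succ hj).le
    nlinarith
  · rw [← neg_smul, hshift, hshift]
    have e1 : (t : ℝ) + (j + 1 : ℕ) * t = (j + 2 : ℕ) * t := by push_cast; ring
    have e2 : -(t : ℝ) + (j + 1 : ℕ) * t = j * t := by push_cast; ring
    rw [e1, e2]
    refine lt_of_mul_lt_mul_left (h.trans_lt ?_) hN0.le
    rw [div_lt_iff₀ hε] at hN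
    nlinarith

end MaxExponent

/-! ### Generic uniqueness, and the finite case -/

section Residual

variable {X : Type*} [MetricSpace X] [CompactSpace X] [MeasurableSpace X]
  [BorelSpace X] {d : ℕ} [NeZero d] {T : X → X} {Λ : Set (ProbabilityMeasure X)}

theorem probabilityMeasure_ext_of_dense {D : Set C(X, ℝ)} (hD : Dense D)
    {μ ν : ProbabilityMeasure X}
    (h : ∀ g ∈ D, ∫ x, g x ∂(μ : Measure X) = ∫ x, g x ∂(ν : Measure X)) : μ = ν := by
  have hc : ∀ ρ : ProbabilityMeasure X,
      Continuous fun g : C(X, ℝ) => ∫ x, g x ∂(ρ : Measure X) := fun ρ =>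
    continuous_integral_pairing.comp (Continuous.prodMk_left ρ)
  have hall := Continuous.ext_on hD (hc μ) (hc ν) h
  refine Subtype.ext (ext_of_forall_integral_eq_of_IsFiniteMeasure (μ := (μ : Measure X))
    (ν := (ν : Measure X)) fun f => ?_)
  exact congrFun hall f.toContinuousMap

theorem uniquelyMaximised_mem_residual (hT : Continuous T) (hinv : Λ ⊆ invariantMeasures T)
    (hne : Λ.Nonempty) (hc : IsCompact Λ) :
    uniquelyMaximised d T Λ ∈ residual C(X, GL (Fin d) ℝ) := by
  have h : ∀ᶠ A in residual C(X, GL (Fin d) ℝ), ∀ i n : ℕ,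
      A ∈ smallSecondDifference T Λ (TopologicalSpace.denseSeq C(X, ℝ) i) (1 / (n + 1)) := by
    refine eventually_countable_forall.2 fun i => eventually_countable_forall.2 fun n => ?_
    exact mem_of_superset (residual_of_dense_open isOpen_interior
      (dense_interior_smallSecondDifference hT hinv hne hc _ (by positivity))) interior_subset
  filter_upwards [h] with A hA
  obtain ⟨μ, hμ⟩ := maximisingMeasures_nonempty hT hne hc A
  refine ⟨μ, Set.eq_singleton_iff_unique_mem.2 ⟨hμ, fun ν hν => ?_⟩⟩
  refine probabilityMeasure_ext_of_dense (TopologicalSpace.denseRange_denseSeq C(X, ℝ)) ?_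
  rintro _ ⟨i, rfl⟩
  have hle : ∀ {μ ν : ProbabilityMeasure X}, μ ∈ maximisingMeasures T Λ A →
      ν ∈ maximisingMeasures T Λ A →
      ∫ x, TopologicalSpace.denseSeq C(X, ℝ) i x ∂(μ : Measure X) ≤
        ∫ x, TopologicalSpace.denseSeq C(X, ℝ) i x ∂(ν : Measure X) := by
    intro μ ν hμ hν
    refine le_of_forall_pos_lt_add fun ε hε => ?_
    obtain ⟨n, hn⟩ := exists_nat_one_div_lt hε
    have := integral_sub_integral_lt hT hinv (hA i n) hμ hν
    linarith
  exact (hle hν hμ).antisymm (hle hμ hν)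

theorem isClosed_invariantMeasures (hT : Continuous T) :
    IsClosed (invariantMeasures T : Set (ProbabilityMeasure X)) := by
  have : (invariantMeasures T : Set (ProbabilityMeasure X)) =
      {μ | μ.map hT.measurable.aemeasurable = μ} := by
    ext μ
    constructor
    · intro (h : MeasurePreserving T _ _)
      exact Subtype.ext h.map_eq
    · intro h
      exact ⟨hT.measurable, congrArg Subtype.val h⟩
  rw [this]
  exact isClosed_eq (ProbabilityMeasure.continuous_map hT) continuous_id

theorem isNowhereDense_compl_uniquelyMaximised (hT : Continuous T)
    (hinv : Λ ⊆ invariantMeasures T) (hne : Λ.Nonempty) (hc : IsCompact Λ) (hfin : Λ.Finite) :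
    IsNowhereDense (uniquelyMaximised d T Λ)ᶜ := by
  have hd : Dense (interior (uniquelyMaximised d T Λ)) := by
    refine dense_of_mem_residual ?_
    have hcont : ∀ᶠ A in residual C(X, GL (Fin d) ℝ), ∀ μ ∈ Λ,
        ContinuousAt (fun B => topExponent T B μ) A := by
      refine (eventually_countable_ball hfin.countable).2 fun μ _ => ?_
      exact eventually_residual_continuousAt
        (upperSemicontinuous_comp_continuous (upperSemicontinuous_topExponent hT)
          (Continuous.prodMk_left μ))
    filter_upwards [hcont, uniquelyMaximised_mem_residual hT hinv hne hc] with A hA hAu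
    rw [mem_interior_iff_mem_nhds]
    obtain ⟨μ, hμ⟩ := hAu
    have hμΛ : μ ∈ maximisingMeasures T Λ A := hμ ▸ rfl
    have hlt : ∀ᶠ B in 𝓝 A, ∀ ν ∈ Λ, ν ≠ μ → topExponent T B ν < topExponent T B μ := by
      refine (eventually_all_finite hfin).2 fun ν hν => ?_
      by_cases hνμ : ν = μ
      · exact Eventually.of_forall fun B h => absurd hνμ h
      have hlt : topExponent T A ν < topExponent T A μ := by
        rw [hμΛ.2]
        refine lt_of_le_of_ne (topExponent_le_maxExponent hT A hν) fun h => hνμ ?_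
        exact hμ.subset ⟨hν, h⟩
      filter_upwards [(hA ν hν).eventually_lt (hA μ hμΛ.1) hlt] with B hB _
      exact hB
    filter_upwards [hlt] with B hB
    have hmax : ∀ ν ∈ maximisingMeasures T Λ B, ν = μ := by
      intro ν hν
      by_contra hne
      refine (hB ν hν.1 hne).not_ge ?_
      rw [hν.2]
      exact topExponent_le_maxExponent hT B hμΛ.1
    obtain ⟨ν, hν⟩ := maximisingMeasures_nonempty hT hne hc B
    exact ⟨μ, Set.eq_singleton_iff_unique_mem.2 ⟨hmax ν hν ▸ hν, hmax⟩⟩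
  rw [IsNowhereDense, closure_compl, interior_eq_empty_iff_dense_compl, compl_compl]
  exact hd

end Residual

/-! ### The mean ergodic theorem for continuous functions -/

section MeanErgodic

variable {X : Type*} [TopologicalSpace X] [CompactSpace X] [T2Space X] [MeasurableSpace X]
  [BorelSpace X] [SecondCountableTopology X] {T : X → X}

/-- The Birkhoff average `(1/n) ∑_{k<n} g ∘ T^k` as a continuous function. -/
def birkhoffMean (hT : Continuous T) (g : C(X, ℝ)) (n : ℕ) : C(X, ℝ) where
  toFun := birkhoffAverage ℝ T g n
  continuous_toFun := by
    exact (continuous_const (y := (n : ℝ)⁻¹)).mul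
      (continuous_finsetSum _ fun k _ => g.continuous.comp (hT.iterate k))

theorem birkhoffMean_apply (hT : Continuous T) (g : C(X, ℝ)) (n : ℕ) (x : X) :
    birkhoffMean hT g n x = (n : ℝ)⁻¹ * birkhoffSum T g n x := rfl

theorem integral_birkhoffMean (hT : Continuous T) {μ : ProbabilityMeasure X}
    (hμ : μ ∈ invariantMeasures T) (g : C(X, ℝ)) {n : ℕ} (hn : n ≠ 0) :
    ∫ x, birkhoffMean hT g n x ∂(μ : Measure X) = ∫ x, g x ∂(μ : Measure X) := by
  simp_rw [birkhoffMean_apply]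
  rw [integral_const_mul, integral_birkhoffSum hT hμ, inv_mul_cancel_left₀]
  exact_mod_cast hn

theorem memLp_continuousMap (φ : C(X, ℝ)) (μ : ProbabilityMeasure X) :
    MemLp φ 2 (μ : Measure X) :=
  MemLp.of_bound φ.continuous.aestronglyMeasurable ‖φ‖ (Eventually.of_forall φ.norm_coe_le_norm)

/-- Jensen's inequality for the square, from `(φ - c - m)² ≥ 0`. -/
theorem sq_integral_sub_le (φ : C(X, ℝ)) (c : ℝ) (μ : ProbabilityMeasure X) :
    (∫ x, φ x ∂(μ : Measure X) - c) ^ 2 ≤ ∫ x, (φ x - c) ^ 2 ∂(μ : Measure X) := by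
  set m := ∫ x, φ x ∂(μ : Measure X) - c with hm
  have hi := integrable_continuousMap φ μ
  calc m ^ 2 = ∫ x, (2 * m * (φ x - c) - m ^ 2) ∂(μ : Measure X) := by
        have hi' : Integrable (fun x => 2 * m * (φ x - c)) (μ : Measure X) :=
          (hi.sub (integrable_const c)).const_mul _
        rw [integral_sub hi' (integrable_const _), integral_const_mul, integral_sub hi (integrable_const c)]
        simp only [integral_const, probReal_univ, one_smul, ← hm]
        ring
    _ ≤ ∫ x, (φ x - c) ^ 2 ∂(μ : Measure X) := by
        refine integral_mono
          (((hi.sub (integrable_const c)).const_mul _).sub (integrable_const _))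
          (integrable_continuousMap ((φ - ContinuousMap.const X c) ^ 2) μ) fun x => ?_
        nlinarith [sq_nonneg (φ x - c - m)]

/-- Von Neumann's theorem for the Koopman operator on `L²(μ)`: the averages converge to the
projection onto the fixed vectors, which by ergodicity are constants. -/
theorem tendsto_integral_sq_birkhoffMean_sub (hT : Continuous T) {μ : ProbabilityMeasure X}
    (hμ : μ ∈ ergodicMeasures T) (g : C(X, ℝ)) :
    Tendsto (fun n =>
      ∫ x, (birkhoffMean hT g n x - ∫ y, g y ∂(μ : Measure X)) ^ 2 ∂(μ : Measure X)) atTop (𝓝 0) := by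
  have hE : Ergodic T (μ : Measure X) := hμ
  have hinv : μ ∈ invariantMeasures T := hE.toMeasurePreserving
  let K : Lp ℝ 2 (μ : Measure X) →L[ℝ] Lp ℝ 2 (μ : Measure X) :=
    (Lp.compMeasurePreservingₗᵢ ℝ T hE.toMeasurePreserving).toContinuousLinearMap
  have hK : ∀ h, K h = Lp.compMeasurePreserving T hE.toMeasurePreserving h := fun _ => rfl
  have hmean := K.tendsto_birkhoffAverage_orthogonalProjection
    (LinearIsometry.norm_toContinuousLinearMap_le _) ((memLp_continuousMap g μ).toLp g)
  set P := (K.eqLocus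
    (1 : Lp ℝ 2 (μ : Measure X) →L[ℝ] Lp ℝ 2 (μ : Measure X))).orthogonalProjectionOnto
    ((memLp_continuousMap g μ).toLp g)
  have hfix : Lp.compMeasurePreserving T hE.toMeasurePreserving (P : Lp ℝ 2 (μ : Measure X)) =
    (P : Lp ℝ 2 (μ : Measure X)) := P.2
  obtain ⟨c, hc⟩ : ∃ c, (P : Lp ℝ 2 (μ : Measure X)) =ᵐ[(μ : Measure X)] Function.const X c := by
    refine hE.ae_eq_const_of_ae_eq_comp_ae (Lp.aestronglyMeasurable _) ?_
    refine (Lp.coeFn_compMeasurePreserving _ hE.toMeasurePreserving).symm.trans ?_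
    rw [hfix]
  have hPc : (P : Lp ℝ 2 (μ : Measure X)) =
      (memLp_continuousMap (ContinuousMap.const X c) μ).toLp _ :=
    Lp.ext (hc.trans (MemLp.coeFn_toLp _).symm)
  have havg : ∀ n, birkhoffAverage ℝ K id n ((memLp_continuousMap g μ).toLp g) =
      (memLp_continuousMap (birkhoffMean hT g n) μ).toLp _ := by
    intro n
    have hk : ∀ k, K^[k] ((memLp_continuousMap g μ).toLp g) =
        (memLp_continuousMap (g.comp ⟨T^[k], hT.iterate k⟩) μ).toLp _ := by
      intro k
      change (Lp.compMeasurePreserving T hE.toMeasurePreserving)^[k] _ = _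
      rw [Lp.compMeasurePreserving_iterate]
      rfl
    have hsum : ∀ s : Finset ℕ, ∑ k ∈ s, (memLp_continuousMap (g.comp ⟨T^[k], hT.iterate k⟩)
        μ).toLp _ = (memLp_continuousMap (∑ k ∈ s, g.comp ⟨T^[k], hT.iterate k⟩) μ).toLp _ := by
      intro s
      induction s using Finset.cons_induction with
      | empty => rfl
      | cons a s ha ih => simp only [Finset.sum_cons, ih]; rfl
    simp only [birkhoffAverage, birkhoffSum, id, hk, hsum]
    rw [← MemLp.toLp_const_smul]
    congr 1
    ext x
    simp [birkhoffMean_apply, birkhoffSum]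
  simp_rw [havg, hPc] at hmean
  have hsq : Tendsto (fun n => ∫ x, (birkhoffMean hT g n x - c) ^ 2 ∂(μ : Measure X))
      atTop (𝓝 0) := by
    have h := (tendsto_iff_norm_sub_tendsto_zero.1 hmean).pow 2
    rw [zero_pow two_ne_zero] at h
    refine h.congr fun n => ?_
    rw [← MemLp.toLp_sub, ← real_inner_self_eq_norm_sq, L2.inner_def]
    refine integral_congr_ae ?_
    filter_upwards [MemLp.coeFn_toLp ((memLp_continuousMap (birkhoffMean hT g n) μ).sub
      (memLp_continuousMap (ContinuousMap.const X c) μ))] with x hx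
    rw [hx]
    simp [sq]
  -- The limit constant is identified by Jensen, since all averages with `n ≠ 0` have integral `∫ g
  -- dμ`.
  suffices hcg : c = ∫ y, g y ∂(μ : Measure X) by rwa [hcg] at hsq
  have hle : ∀ n : ℕ, n ≠ 0 → (∫ y, g y ∂(μ : Measure X) - c) ^ 2 ≤
      ∫ x, (birkhoffMean hT g n x - c) ^ 2 ∂(μ : Measure X) := by
    intro n hn
    rw [← integral_birkhoffMean hT hinv g hn]
    exact sq_integral_sub_le (birkhoffMean hT g n) c μ
  have h0 : (∫ y, g y ∂(μ : Measure X) - c) ^ 2 ≤ 0 :=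
    ge_of_tendsto hsq ((eventually_ne_atTop 0).mono hle)
  nlinarith [pow_eq_zero_iff two_ne_zero |>.1 (le_antisymm h0 (sq_nonneg _))]

end MeanErgodic

/-! ### Separating ergodic measures; density of maximising measures -/

section Density

variable {X : Type*} [MetricSpace X] [CompactSpace X] [MeasurableSpace X]
  [BorelSpace X] {d : ℕ} [NeZero d] {T : X → X} {Λ : Set (ProbabilityMeasure X)}

theorem exists_integral_ne {μ ν : ProbabilityMeasure X} (h : μ ≠ ν) :
    ∃ g : C(X, ℝ), ∫ x, g x ∂(μ : Measure X) ≠ ∫ x, g x ∂(ν : Measure X) := by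
  by_contra! hg
  exact h (probabilityMeasure_ext_of_dense dense_univ fun g _ => hg g)

/-- An ergodic measure is separated from any compact set of other invariant measures by the
integral of a continuous function. -/
theorem exists_continuousMap_separating (hT : Continuous T) {μ₀ : ProbabilityMeasure X}
    (hμ₀ : μ₀ ∈ ergodicMeasures T) {K : Set (ProbabilityMeasure X)} (hK : IsCompact K)
    (hinv : K ⊆ invariantMeasures T) (hnot : μ₀ ∉ K) {η : ℝ} (hη : 0 < η) :
    ∃ F : C(X, ℝ), (∀ x, F x ≤ 0) ∧ -η < ∫ x, F x ∂(μ₀ : Measure X) ∧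
      ∀ μ ∈ K, ∫ x, F x ∂(μ : Measure X) ≤ -1 := by
  -- `η` is quantified inside the induction because a union spends `η/2` on each piece; as both
  -- functions are nonpositive, their sum keeps the bound `-1` on either piece.
  refine hK.induction_on (p := fun s => ∀ η : ℝ, 0 < η → ∃ F : C(X, ℝ), (∀ x, F x ≤ 0) ∧
      -η < ∫ x, F x ∂(μ₀ : Measure X) ∧ ∀ μ ∈ s, ∫ x, F x ∂(μ : Measure X) ≤ -1)
    ?_ ?_ ?_ ?_ η hη
  · intro η hη
    exact ⟨0, by simp, by simpa using hη, by simp⟩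
  · intro s t hst ht η hη
    obtain ⟨F, h1, h2, h3⟩ := ht η hη
    exact ⟨F, h1, h2, fun μ hμ => h3 μ (hst hμ)⟩
  · intro s t hs ht η hη
    obtain ⟨F, hF1, hF2, hF3⟩ := hs (η / 2) (half_pos hη)
    obtain ⟨G, hG1, hG2, hG3⟩ := ht (η / 2) (half_pos hη)
    have hadd : ∀ μ : ProbabilityMeasure X, ∫ x, (F + G) x ∂(μ : Measure X) =
        ∫ x, F x ∂(μ : Measure X) + ∫ x, G x ∂(μ : Measure X) := fun μ =>
      integral_add (integrable_continuousMap F μ) (integrable_continuousMap G μ)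
    refine ⟨F + G, fun x => add_nonpos (hF1 x) (hG1 x), ?_, ?_⟩
    · rw [hadd]
      linarith
    · intro μ hμ
      rw [hadd]
      have h1 : ∫ x, F x ∂(μ : Measure X) ≤ 0 := integral_nonpos hF1
      have h2 : ∫ x, G x ∂(μ : Measure X) ≤ 0 := integral_nonpos hG1
      rcases hμ with hμ | hμ
      · linarith [hF3 μ hμ]
      · linarith [hG3 μ hμ]
  · intro μ hμ
    obtain ⟨g, hg⟩ := exists_integral_ne (ne_of_mem_of_not_mem hμ hnot)
    set c := ∫ x, g x ∂(μ₀ : Measure X) with hc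
    have hpos : 0 < (∫ x, g x ∂(μ : Measure X) - c) ^ 2 := by
      have := sub_ne_zero.2 hg
      positivity
    -- The function will be `-a⁻¹(S_n g/n - c)²`. Jensen and invariance give integral at most `-1`
    -- wherever `(∫ g dν - c)² > a`, for every `n ≠ 0`; only the bound at `μ₀` needs `n` large.
    obtain ⟨a, ha0, ha⟩ := exists_between hpos
    have hcont : Continuous fun ν : ProbabilityMeasure X =>
        (∫ x, g x ∂(ν : Measure X) - c) ^ 2 :=
      ((ProbabilityMeasure.continuous_integral_continuousMap g).sub continuous_const).pow 2
    refine ⟨{ν | ν ∈ K ∧ a < (∫ x, g x ∂(ν : Measure X) - c) ^ 2},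
      inter_mem self_mem_nhdsWithin (mem_nhdsWithin_of_mem_nhds
        (hcont.continuousAt.eventually_const_lt ha)), fun η hη => ?_⟩
    have hlim := (tendsto_integral_sq_birkhoffMean_sub hT hμ₀ g).eventually_lt_const
      (mul_pos ha0 hη)
    obtain ⟨n, hn, hn0⟩ := (hlim.and (eventually_ne_atTop 0)).exists
    have hF : ∀ ν : ProbabilityMeasure X,
        ∫ x, (-(a⁻¹ • (birkhoffMean hT g n - ContinuousMap.const X c) ^ 2)) x ∂(ν : Measure X) =
          -(a⁻¹ * ∫ x, (birkhoffMean hT g n x - c) ^ 2 ∂(ν : Measure X)) := by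
      intro ν
      rw [← integral_const_mul, ← integral_neg]
      rfl
    refine ⟨-(a⁻¹ • (birkhoffMean hT g n - ContinuousMap.const X c) ^ 2), fun x => ?_, ?_, ?_⟩
    · have : 0 ≤ a⁻¹ * (birkhoffMean hT g n x - c) ^ 2 := by positivity
      simpa using this
    · rw [hF, neg_lt_neg_iff, inv_mul_lt_iff₀ ha0]
      exact hn
    · rintro ν ⟨hνK, hν⟩
      rw [hF, neg_le_neg_iff, le_inv_mul_iff₀ ha0, mul_one]
      rw [← integral_birkhoffMean hT (hinv hνK) g hn0] at hν
      exact hν.le.trans (sq_integral_sub_le _ c ν)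

theorem abs_topExponent_le (hT : Continuous T) {B : C(X, GL (Fin d) ℝ)} {δ : ℝ}
    (h1 : ‖(logOpNorm d).comp B‖ < δ) (h2 : ‖(logOpNorm d).comp B⁻¹‖ < δ)
    (μ : ProbabilityMeasure X) : |topExponent T B μ| ≤ δ := by
  refine abs_le.2 ⟨le_topExponent hT (fun x => ?_) μ, topExponent_le hT (fun x => ?_) μ⟩
  · exact ((le_abs_self _).trans (((logOpNorm d).comp B⁻¹).norm_coe_le_norm x)).trans h2.le
  · exact ((le_abs_self _).trans (((logOpNorm d).comp B).norm_coe_le_norm x)).trans h1.le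

theorem ergodic_mem_closure_maximisingMeasures (hT : Continuous T)
    (hinv : Λ ⊆ invariantMeasures T) (hcomp : IsCompact Λ) {μ₀ : ProbabilityMeasure X}
    (hμ₀ : μ₀ ∈ Λ ∩ ergodicMeasures T) {D : Set C(X, GL (Fin d) ℝ)} (hD : Dense D) :
    μ₀ ∈ closure (⋃ A ∈ D, maximisingMeasures T Λ A) := by
  refine mem_closure_iff.2 fun W hW hμW => ?_
  obtain ⟨F, -, hF₀, hF⟩ := exists_continuousMap_separating hT hμ₀.2 (hcomp.diff hW)
    (Set.sdiff_subset.trans hinv) (fun h => h.2 hμW) (show (0 : ℝ) < 1 / 3 by norm_num)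
  have hopen : IsOpen {B : C(X, GL (Fin d) ℝ) |
      ‖(logOpNorm d).comp B‖ < 1 / 3 ∧ ‖(logOpNorm d).comp B⁻¹‖ < 1 / 3} := by
    have hl := (logOpNorm d).continuous_postcomp (X := X)
    have hi : Continuous fun B : C(X, GL (Fin d) ℝ) => B⁻¹ :=
      ContinuousMap.continuous_postcomp ⟨fun M => M⁻¹, continuous_inv⟩
    exact (isOpen_lt hl.norm continuous_const).inter
      (isOpen_lt (hl.comp hi).norm continuous_const)
  have hone : (logOpNorm d).comp (1 : C(X, GL (Fin d) ℝ)) = 0 := by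
    ext x
    exact logOpNorm_one
  -- Density gives `A = e^F B` with `B` so near the identity that all its exponents lie in `[-1/3,
  -- 1/3]`.
  obtain ⟨A, hA, hAD⟩ := hD.inter_open_nonempty _
    (hopen.preimage (continuous_expMul_right (-F))) ⟨expMul F 1, by
      rw [Set.mem_preimage, ← expMul_add, neg_add_cancel, expMul_zero]
      constructor <;> simp [hone]⟩
  have hexp : ∀ μ ∈ Λ, topExponent T A μ = ∫ x, F x ∂(μ : Measure X) +
      topExponent T (expMul (-F) A) μ := by
    intro μ hμ
    rw [← topExponent_expMul hT (hinv hμ), ← expMul_add, add_neg_cancel, expMul_zero]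
  have hsmall := fun μ => abs_le.1 (abs_topExponent_le hT hA.1 hA.2 μ)
  obtain ⟨ν, hν⟩ := maximisingMeasures_nonempty hT ⟨μ₀, hμ₀.1⟩ hcomp A
  refine ⟨ν, ?_, Set.mem_biUnion hAD hν⟩
  by_contra hνW
  have h1 := topExponent_le_maxExponent hT A hμ₀.1
  rw [← hν.2, hexp ν hν.1, hexp μ₀ hμ₀.1] at h1
  have h2 := hF ν ⟨hν.1, hνW⟩
  -- The exponent at `μ₀` exceeds `-1/3 - 1/3`, while outside `W` it is at most `-1 + 1/3`.
  linarith [(hsmall μ₀).1, (hsmall ν).2]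

end Density

end LyapunovOptimisation

end

theorem theoremA {X : Type*} [MetricSpace X] [CompactSpace X] [MeasurableSpace X] [BorelSpace X]
    (T : X → X) (hT : Continuous T) (d : ℕ) (hd : 1 ≤ d)
    (Λ : Set (ProbabilityMeasure X)) (hinv : Λ ⊆ LyapunovOptimisation.invariantMeasures T)
    (hne : Λ.Nonempty) (hcomp : IsCompact Λ) :
    (LyapunovOptimisation.IsResidual (LyapunovOptimisation.uniquelyMaximised d T Λ) ∧
      LyapunovOptimisation.IsResidual (LyapunovOptimisation.uniquelyMaximised d T
        (LyapunovOptimisation.invariantMeasures T))) ∧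
    (Λ.Finite → IsNowhereDense (LyapunovOptimisation.uniquelyMaximised d T Λ)ᶜ) ∧
    (closure (Λ ∩ LyapunovOptimisation.ergodicMeasures T) = Λ →
      ∀ F : Set C(X, GL (Fin d) ℝ), Dense F →
        Λ ⊆ closure (⋃ A ∈ F, LyapunovOptimisation.maximisingMeasures T Λ A)) := by
  have : NeZero d := ⟨by omega⟩
  have hsub : Λ ⊆ closure (Λ ∩ LyapunovOptimisation.ergodicMeasures T) →
      ∀ F : Set C(X, GL (Fin d) ℝ), Dense F →
        Λ ⊆ closure (⋃ A ∈ F, LyapunovOptimisation.maximisingMeasures T Λ A) := fun h F hF =>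
    h.trans (closure_minimal (fun _ hμ =>
      LyapunovOptimisation.ergodic_mem_closure_maximisingMeasures hT hinv hcomp hμ hF)
      isClosed_closure)
  exact ⟨⟨mem_residual.1 (LyapunovOptimisation.uniquelyMaximised_mem_residual hT hinv hne hcomp),
    mem_residual.1 (LyapunovOptimisation.uniquelyMaximised_mem_residual hT subset_rfl
      (hne.mono hinv) (LyapunovOptimisation.isClosed_invariantMeasures hT).isCompact)⟩,
    LyapunovOptimisation.isNowhereDense_compl_uniquelyMaximised hT hinv hne hcomp,
    fun h => hsub h.ge⟩
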